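/- **Setting.** $K$ single-antenna users with transmit powers $p=(p_1,\dots,p_K)$ reach a base station (Bob, $N_B$ antennas) through a reconfigurable surface with $N$ elements and fixed reflection vector $\gamma\in\mathbb C^N$; an eavesdropper (Eve) listens. Let $h_k\in\mathbb C^N$ and $G_B\in\mathbb C^{N_B\times N}$ be the user–surface and surface–Bob channels, $\hat g_E\in\mathbb C^N$ the mean and $\sigma_g^2\ge 0$ the uncertainty variance of the surface–Eve channel, $\sigma_B^2,\sigma_E^2>0$ and $\sigma_{RIS}^2\ge0$ the noise variances, and $c_k\in\mathbb C^{N_B}\setminus\{0\}$ fixed receive filters. Put $H_k=\mathrm{diag}(h_k)$, $A_k=G_BH_k$, $\Gamma=\mathrm{diag}(\gamma)$, $W_B=\sigma_B^2I+\sigma_{RIS}^2G_B\Gamma\Gamma^HG_B^H$, $R_E=\hat g_E\hat g_E^H+\sigma_g^2I$, and $$a^{(B)}_{k,m}=|c_k^HA_m\gamma|^2,\quad d_{k,B}=c_k^HW_Bc_k,\quad a^{(E)}_m=\|R_E^{1/2}H_m\gamma\|^2,\quad d_E=\sigma_{RIS}^2\|R_E^{1/2}\gamma\|^2+\sigma_E^2,$$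 $$\mu_{k,eq}=\mu_k-\|h_k\|^2+\|H_k\gamma\|^2,\qquad P_{c,eq}=\sigma_{RIS}^2(\|\gamma\|^2-N)+P_c,\qquad P_c=NP_{c,n}+P_0^{RIS}+P_0 ,$$ where the $\mu_k$ are inverse amplifier efficiencies and $P_{c,n},P_0^{RIS},P_0$ static powers. Let $\mathcal B=\prod_k[0,P_{max,k}]$, let $P(p)=\sum_k\mu_{k,eq}p_k+P_{c,eq}$ be the total consumed power, and assume $P(p)>0$ for $p\in\mathcal B$. The power allocation problem is to maximize over $p\in\mathcal B$ $$f(p)=\frac{R_s(p)}{P(p)},\qquad R_s(p)=\sum_{k=1}^K\log_2\Bigl(1+\tfrac{p_ka^{(B)}_{k,k}}{d_{k,B}+\sum_{m\ne k}p_ma^{(B)}_{k,m}}\Bigr)-\log_2\Bigl(1+\tfrac{p_ka^{(E)}_k}{d_E+\sum_{m\ne k}p_ma^{(E)}_m}\Bigr).$$ Write $R_s=g_1-g_2$ with the concave functions $$g_1(p)=\sum_k\Bigl[\log_2\bigl(d_{k,B}+\sum_{m}p_ma^{(B)}_{k,m}\bigr)+\log_2\bigl(d_E+\sum_{m\ne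 k}p_ma^{(E)}_m\bigr)\Bigr],$$ $$g_2(p)=\sum_k\Bigl[\log_2\bigl(d_{k,B}+\sum_{m\ne k}p_ma^{(B)}_{k,m}\bigr)+\log_2\bigl(d_E+\sum_{m}p_ma^{(E)}_m\bigr)\Bigr].$$ **Algorithm.** Start from any $p^{(0)}\in\mathcal B$; let $p^{(n+1)}$ be a maximizer over $\mathcal B$ of the surrogate $$p\mapsto\frac{g_1(p)-g_2(\bar p)-\nabla g_2(\bar p)^T(p-\bar p)}{P(p)},\qquad \bar p=p^{(n)};$$ the iteration is stopped when $\|p^{(n+1)}-p^{(n)}\|<\epsilon$ for a given tolerance $\epsilon>0$. **Proposition.** 1. For every $\bar p\in\mathcal B$ the surrogate problem has a solution, and only one if $a^{(B)}_{k,k}>0$ and $a^{(E)}_k>0$ for all $k$. 2. Along every sequence of iterates $f(p^{(n)})$ is nondecreasing, and $f(p^{(n+1)})>f(p^{(n)})$ unless $p^{(n)}$ satisfies the KKT conditions of the power allocation problem. 3. For every sequence of iterates, $f(p^{(n)})$ converges to a number $v$. The sequence has limit points, every limit point satisfies the KKT conditions of the power allocation problem and has objective value $v$, and the distance from $p^{(n)}$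 to the set $\mathcal K_v$ of KKT points with objective value $v$ tends to $0$. 4. If the solution of the surrogate problem is unique for each $\bar p\in\mathcal B$, then moreover $\|p^{(n+1)}-p^{(n)}\|\to0$, so that the stopping rule is met for every $\epsilon>0$; once an iterate is a KKT point, all later iterates coincide with it; and the iterates converge to a single KKT point whenever $\mathcal K_v$ is totally disconnected (in particular if its points are isolated). -/

import Mathlib

open Filter Topology Matrix

noncomputable section

/-- The data of the uplink of `K` single-antenna users to a base station (Bob) with `NB` antennas
through a reconfigurable surface (RIS) with `N` elements, in the presence of an eavesdropper (Eve),
together with the surface coefficients and the receive filters, which are held fixed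
while the powers are optimized. -/
structure SecrecyNetwork (K N NB : ℕ) where
  /-- channel from user `k` to the RIS -/
  h : Fin K → Fin N → ℂ
  /-- channel from the RIS to Bob -/
  GB : Matrix (Fin NB) (Fin N) ℂ
  /-- mean of the channel from the RIS to Eve -/
  gE : Fin N → ℂ
  /-- variance of the uncertainty of the channel from the RIS to Eve -/
  varG : ℝ
  /-- noise variance at Bob -/
  varB : ℝ
  /-- noise variance at Eve -/
  varE : ℝ
  /-- noise variance at the RIS -/
  varRIS : ℝ
  /-- RIS reflection coefficients -/
  gam : Fin N → ℂ
  /-- receive filter of user `k` at Bob -/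
  c : Fin K → Fin NB → ℂ
  /-- inverse amplifier efficiencies -/
  mu : Fin K → ℝ
  /-- static power of one RIS element -/
  Pcn : ℝ
  /-- remaining static power of the RIS -/
  P0RIS : ℝ
  /-- all other static power -/
  P0 : ℝ
  /-- maximum transmit powers -/
  Pmax : Fin K → ℝ

namespace SecrecyNetwork

variable {K N NB : ℕ} (S : SecrecyNetwork K N NB)

/-- The squared Euclidean norm of a complex vector. -/
def sqNorm {n : ℕ} (v : Fin n → ℂ) : ℝ := ∑ i, ‖v i‖ ^ 2

/-- The (real) quadratic form `v ↦ vᴴ M v` of a Hermitian matrix. -/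
def quadForm {n : ℕ} (M : Matrix (Fin n) (Fin n) ℂ) (v : Fin n → ℂ) : ℝ :=
  (star v ⬝ᵥ (M *ᵥ v)).re

/-- `H_k = diag(h_k)`. -/
def H (k : Fin K) : Matrix (Fin N) (Fin N) ℂ := Matrix.diagonal (S.h k)

/-- `Γ = diag(γ)`. -/
def Gam : Matrix (Fin N) (Fin N) ℂ := Matrix.diagonal S.gam

/-- `A_k = G_B H_k`. -/
def A (k : Fin K) : Matrix (Fin NB) (Fin N) ℂ := S.GB * S.H k

/-- The noise covariance matrix at Bob, `W_B = σ_B² I + σ_RIS² G_B Γ Γᴴ G_Bᴴ`. -/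
def WB : Matrix (Fin NB) (Fin NB) ℂ :=
  (S.varB : ℂ) • (1 : Matrix (Fin NB) (Fin NB) ℂ)
    + (S.varRIS : ℂ) • (S.GB * S.Gam * S.Gamᴴ * S.GBᴴ)

/-- `R_E = ĝ_E ĝ_Eᴴ + σ_g² I`. -/
def RE : Matrix (Fin N) (Fin N) ℂ :=
  Matrix.vecMulVec S.gE (star S.gE) + (S.varG : ℂ) • (1 : Matrix (Fin N) (Fin N) ℂ)

/-- `a^(B)_{k,m} = |c_kᴴ A_m γ|²`. -/
def aB (k m : Fin K) : ℝ := ‖star (S.c k) ⬝ᵥ (S.A m *ᵥ S.gam)‖ ^ 2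

/-- `d_{k,B} = c_kᴴ W_B c_k`. -/
def dB (k : Fin K) : ℝ := quadForm S.WB (S.c k)

/-- `a^(E)_m = ‖R_E^{1/2} H_m γ‖² = (H_m γ)ᴴ R_E (H_m γ)`. -/
def aE (m : Fin K) : ℝ := quadForm S.RE (S.H m *ᵥ S.gam)

/-- `d_E = σ_RIS² ‖R_E^{1/2} γ‖² + σ_E²`. -/
def dE : ℝ := S.varRIS * quadForm S.RE S.gam + S.varE

/-- `P_c = N P_{c,n} + P_0^RIS + P_0`. -/
def Pc : ℝ := N * S.Pcn + S.P0RIS + S.P0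

/-- `P_{c,eq} = σ_RIS² (‖γ‖² - N) + P_c`. -/
def Pceq : ℝ := S.varRIS * (sqNorm S.gam - N) + S.Pc

/-- `μ_{k,eq} = μ_k - ‖h_k‖² + ‖H_k γ‖²`. -/
def mueq (k : Fin K) : ℝ := S.mu k - sqNorm (S.h k) + sqNorm (S.H k *ᵥ S.gam)

/-- The total consumed power as a function of the transmit powers. -/
def Ptot (p : EuclideanSpace ℝ (Fin K)) : ℝ := ∑ k, S.mueq k * p k + S.Pceq

/-- The SINR of user `k` at Bob. -/
def sinrB (p : EuclideanSpace ℝ (Fin K)) (k : Fin K) : ℝ :=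
  p k * S.aB k k / (S.dB k + ∑ m ∈ Finset.univ.erase k, p m * S.aB k m)

/-- The SINR of user `k` at Eve, with the uncertain channel averaged. -/
def sinrE (p : EuclideanSpace ℝ (Fin K)) (k : Fin K) : ℝ :=
  p k * S.aE k / (S.dE + ∑ m ∈ Finset.univ.erase k, p m * S.aE m)

/-- The secrecy rate. -/
def secrecyRate (p : EuclideanSpace ℝ (Fin K)) : ℝ :=
  ∑ k, (Real.logb 2 (1 + S.sinrB p k) - Real.logb 2 (1 + S.sinrE p k))

/-- The objective of the power allocation problem: the secrecy energy efficiency. -/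
def objective (p : EuclideanSpace ℝ (Fin K)) : ℝ := S.secrecyRate p / S.Ptot p

/-- The feasible set of the power allocation problem. -/
def box : Set (EuclideanSpace ℝ (Fin K)) := {p | ∀ k, 0 ≤ p k ∧ p k ≤ S.Pmax k}

/-- The concave function `g₁` in the decomposition `g₁ - g₂` of the secrecy rate. -/
def g1 (p : EuclideanSpace ℝ (Fin K)) : ℝ :=
  ∑ k, (Real.logb 2 (S.dB k + ∑ m, p m * S.aB k m)
    + Real.logb 2 (S.dE + ∑ m ∈ Finset.univ.erase k, p m * S.aE m))

/-- The concave function `g₂` in the decomposition `g₁ - g₂` of the secrecy rate. -/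
def g2 (p : EuclideanSpace ℝ (Fin K)) : ℝ :=
  ∑ k, (Real.logb 2 (S.dB k + ∑ m ∈ Finset.univ.erase k, p m * S.aB k m)
    + Real.logb 2 (S.dE + ∑ m, p m * S.aE m))

/-- The surrogate of the secrecy rate: `g₂` is linearized at `pbar`. -/
def surrogateRate (pbar p : EuclideanSpace ℝ (Fin K)) : ℝ :=
  S.g1 p - S.g2 pbar - inner ℝ (gradient S.g2 pbar) (p - pbar)

/-- The objective of the surrogate problem at `pbar`. -/
def surrogate (pbar p : EuclideanSpace ℝ (Fin K)) : ℝ := S.surrogateRate pbar p / S.Ptot p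

/-- `q` is a (global) solution of the surrogate problem at `pbar`. -/
def SolvesSurrogate (pbar q : EuclideanSpace ℝ (Fin K)) : Prop :=
  q ∈ S.box ∧ IsMaxOn (S.surrogate pbar) S.box q

/-- A sequence of iterates of the power optimization algorithm: it starts at a feasible point, and
each further iterate is a solution of the surrogate problem at the previous one. -/
def IsRun (p : ℕ → EuclideanSpace ℝ (Fin K)) : Prop :=
  p 0 ∈ S.box ∧ ∀ n, S.SolvesSurrogate (p n) (p (n + 1))

/-- The KKT conditions, at `p`, of the problem of maximizing `objective` subject to
`0 ≤ p k ≤ Pmax k`: feasibility, stationarity of the Lagrangian, nonnegative multipliers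
`lo k` and `up k` of the lower and the upper bounds, and complementary slackness. -/
def IsKKT (p : EuclideanSpace ℝ (Fin K)) : Prop :=
  p ∈ S.box ∧ DifferentiableAt ℝ S.objective p ∧
    ∃ lo up : Fin K → ℝ, ∀ k, 0 ≤ lo k ∧ 0 ≤ up k ∧
      gradient S.objective p k + lo k - up k = 0 ∧
      lo k * p k = 0 ∧ up k * (S.Pmax k - p k) = 0

end SecrecyNetwork

end

/-! The algorithm is minorization-maximization. Since `g2` is concave, linearizing it bounds it from
above, so the surrogate is a minorant `s x` of the objective `f` that touches it at `x`. Hence `f (p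
n) = s (p n) (p n) ≤ s (p n) (p (n+1)) ≤ f (p (n+1))`.

KKT points are exactly the fixed points, i.e. the `q` maximizing their own surrogate
(`Admissible.isKKT_iff`). At `q` the surrogate and the objective have the same gradient. A concave
numerator over a positive affine denominator makes the first-order variational inequality sufficient
for a global maximum, and on a box this inequality amounts to the existence of multipliers.

Convergence uses only compactness and joint continuity of `s`. Passing to the limit in `s (p n) y ≤
v` shows that cluster points are fixed points (`mapClusterPt_spec`). With unique maximizers the
steps vanish (`tendsto_dist_succ`), so the cluster set is connected and is a single point inside a
totally disconnected set. -/

/-! ### Cluster points of sequences in a compact set -/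

theorem IsCompact.tendsto_infDist_of_mapClusterPt {ι E : Type*} [PseudoMetricSpace E] {B C : Set E}
    (hB : IsCompact B) {l : Filter ι} {p : ι → E} (hp : ∀ᶠ n in l, p n ∈ B)
    (hC : ∀ q, MapClusterPt q l p → q ∈ C) :
    Tendsto (fun n => Metric.infDist (p n) C) l (𝓝 0) := by
  refine (nhds_basis_zero_abs_lt ℝ).tendsto_right_iff.2 fun ε hε => ?_
  refine hB.adherence_nhdset (f := map p l) (t := {x | |Metric.infDist x C| < ε})
    (tendsto_principal.2 hp)
    (isOpen_lt (Metric.continuous_infDist_pt C).abs continuous_const) fun q _ hq => ?_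
  simpa [Metric.infDist_zero_of_mem (hC q hq)] using hε

/-- If the cluster set split into two disjoint closed pieces, compactness would put a gap between
them. The sequence is eventually close to their union with steps too short to cross the gap, so it
cannot visit both pieces infinitely often. -/
theorem isPreconnected_setOf_mapClusterPt {E : Type*} [MetricSpace E] {B : Set E}
    (hB : IsCompact B) {p : ℕ → E} (hp : ∀ n, p n ∈ B)
    (hstep : Tendsto (fun n => dist (p (n + 1)) (p n)) atTop (𝓝 0)) :
    IsPreconnected {q | MapClusterPt q atTop p} := by
  set C := {q | MapClusterPt q atTop p} with hCdef
  have hCB : C ⊆ B := fun q hq => by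
    obtain ⟨U, hU, hUq⟩ := mapClusterPt_iff_ultrafilter.1 hq
    exact hB.isClosed.mem_of_tendsto hUq (Eventually.of_forall hp)
  have hCc : IsClosed C := isClosed_setOfPred_clusterPt
  rw [isPreconnected_iff_subset_of_disjoint_closed]
  intro u w hu hw huw hdisj
  by_contra! hcon
  obtain ⟨⟨y, hyC, hyu⟩, ⟨x, hxC, hxw⟩⟩ := And.imp Set.not_subset.1 Set.not_subset.1 hcon
  have hCu : IsCompact (C ∩ u) := hB.of_isClosed_subset (hCc.inter hu) (Set.inter_subset_left.trans hCB)
  have hCw : IsClosed (C ∩ w) := hCc.inter hw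
  have hd : Disjoint (C ∩ u) (C ∩ w) := by
    rw [Set.disjoint_iff_inter_eq_empty, ← Set.inter_inter_distrib_left, hdisj]
  obtain ⟨δ, hδ, hδd⟩ := hd.exists_thickenings hCu hCw
  have hev : ∀ᶠ n in atTop, p n ∈ Metric.thickening (δ / 2) (C ∩ u) ∪
      Metric.thickening (δ / 2) (C ∩ w) := by
    refine hB.adherence_nhdset (f := map p atTop) ?_
      (Metric.isOpen_thickening.union Metric.isOpen_thickening) fun z _ hz => ?_
    · exact tendsto_principal.2 (Eventually.of_forall hp)
    · rcases huw (show z ∈ C from hz) with h | h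
      · exact Or.inl (Metric.self_subset_thickening (half_pos hδ) _ ⟨hz, h⟩)
      · exact Or.inr (Metric.self_subset_thickening (half_pos hδ) _ ⟨hz, h⟩)
  obtain ⟨M, hM⟩ := eventually_atTop.1 (hev.and (hstep.eventually_lt_const (half_pos hδ)))
  have hxu : x ∈ C ∩ u := ⟨hxC, (huw hxC).resolve_right hxw⟩
  have hyw : y ∈ C ∩ w := ⟨hyC, (huw hyC).resolve_left hyu⟩
  obtain ⟨n, hn, hnu⟩ := (frequently_atTop.1 (MapClusterPt.frequently hxC
    (Metric.isOpen_thickening.mem_nhds (Metric.self_subset_thickening (half_pos hδ) _ hxu)))) M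
  have hstay : ∀ m ≥ n, p m ∈ Metric.thickening (δ / 2) (C ∩ u) := by
    intro m hm
    induction m, hm using Nat.le_induction with
    | base => exact hnu
    | succ m hm ih =>
      refine (hM (m + 1) (by omega)).1.resolve_right fun hw' => ?_
      obtain ⟨a, ha, hda⟩ := Metric.mem_thickening_iff.1 ih
      -- A step shorter than `δ / 2` from a point within `δ / 2` of the first piece stays within `δ`
      -- of it. Being near the second piece as well contradicts disjointness of the `δ`-thickenings.
      refine hδd.le_bot ⟨Metric.mem_thickening_iff.2 ⟨a, ha, ?_⟩,
        Metric.thickening_mono (by linarith) _ hw'⟩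
      linarith [dist_triangle (p (m + 1)) (p m) a, (hM m (by omega)).2]
  obtain ⟨m, hm, hmw⟩ := (frequently_atTop.1 (MapClusterPt.frequently hyC
    (Metric.isOpen_thickening.mem_nhds (Metric.self_subset_thickening (half_pos hδ) _ hyw)))) n
  exact hδd.le_bot ⟨Metric.thickening_mono (by linarith) _ (hstay m hm),
    Metric.thickening_mono (by linarith) _ hmw⟩

/-! ### Minorization-maximization on a compact set -/

/-- `s` is a family of minorants of `f` on `B`: `s x` touches `f` at `x`, and `s` is jointly
continuous. -/
structure IsMinorantFamily {E : Type*} [TopologicalSpace E] (B : Set E) (f : E → ℝ)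
    (s : E → E → ℝ) : Prop where
  continuousOn : ContinuousOn (fun z : E × E => s z.1 z.2) (B ×ˢ B)
  touch : ∀ x ∈ B, s x x = f x
  le : ∀ x ∈ B, ∀ y ∈ B, s x y ≤ f y

/-- A sequence produced by minorization-maximization over `B` with the surrogates `s`. -/
def IsMMSeq {E : Type*} (B : Set E) (s : E → E → ℝ) (p : ℕ → E) : Prop :=
  p 0 ∈ B ∧ ∀ n, p (n + 1) ∈ B ∧ IsMaxOn (s (p n)) B (p (n + 1))

theorem IsMMSeq.mem {E : Type*} {B : Set E} {s : E → E → ℝ} {p : ℕ → E} (hp : IsMMSeq B s p) :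
    ∀ n, p n ∈ B
  | 0 => hp.1
  | n + 1 => (hp.2 n).1

namespace IsMinorantFamily

section Topological

variable {E : Type*} [TopologicalSpace E] {B : Set E} {f : E → ℝ} {s : E → E → ℝ}
  {p : ℕ → E}

theorem continuousOn_right (hs : IsMinorantFamily B f s) {x : E} (hx : x ∈ B) :
    ContinuousOn (s x) B :=
  hs.continuousOn.comp (f := fun y => (x, y)) (by fun_prop) fun _ hy => ⟨hx, hy⟩

theorem continuousOn_left (hs : IsMinorantFamily B f s) {y : E} (hy : y ∈ B) :
    ContinuousOn (fun x => s x y) B :=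
  hs.continuousOn.comp (f := fun x => (x, y)) (by fun_prop) fun _ hx => ⟨hx, hy⟩

theorem continuousOn_objective (hs : IsMinorantFamily B f s) : ContinuousOn f B :=
  (hs.continuousOn.comp (f := fun x => (x, x)) (by fun_prop) fun _ hx => ⟨hx, hx⟩).congr
    fun x hx => (hs.touch x hx).symm

theorem exists_isMaxOn (hs : IsMinorantFamily B f s) (hB : IsCompact B) {x : E} (hx : x ∈ B) :
    ∃ q ∈ B, IsMaxOn (s x) B q :=
  hB.exists_isMaxOn ⟨x, hx⟩ (hs.continuousOn_right hx)

theorem le_surrogate_succ (hs : IsMinorantFamily B f s) (hp : IsMMSeq B s p) (n : ℕ) :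
    f (p n) ≤ s (p n) (p (n + 1)) :=
  hs.touch _ (hp.mem n) ▸ (hp.2 n).2 (hp.mem n)

theorem surrogate_succ_le (hs : IsMinorantFamily B f s) (hp : IsMMSeq B s p) (n : ℕ) :
    s (p n) (p (n + 1)) ≤ f (p (n + 1)) :=
  hs.le _ (hp.mem n) _ (hp.mem _)

theorem monotone (hs : IsMinorantFamily B f s) (hp : IsMMSeq B s p) :
    Monotone fun n => f (p n) :=
  monotone_nat_of_le_succ fun n => (hs.le_surrogate_succ hp n).trans (hs.surrogate_succ_le hp n)

/-- Without strict increase the maximum of `s (p n)` would be at most `f (p n) = s (p n) (p n)`, so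
`p n` would attain it. -/
theorem lt_succ (hs : IsMinorantFamily B f s) (hp : IsMMSeq B s p) {n : ℕ}
    (hn : ¬ IsMaxOn (s (p n)) B (p n)) : f (p n) < f (p (n + 1)) := by
  refine lt_of_not_ge fun h => hn fun y hy => ?_
  have h1 := (hp.2 n).2 hy
  have h2 := hs.surrogate_succ_le hp n
  have h3 := hs.touch _ (hp.mem n)
  simp only [Set.mem_ofPred_eq] at h1 ⊢
  linarith

theorem exists_tendsto (hs : IsMinorantFamily B f s) (hB : IsCompact B) (hp : IsMMSeq B s p) :
    ∃ v, Tendsto (fun n => f (p n)) atTop (𝓝 v) := by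
  refine ⟨_, tendsto_atTop_ciSup (hs.monotone hp) ?_⟩
  refine (hB.bddAbove_image hs.continuousOn_objective).mono ?_
  rintro _ ⟨n, rfl⟩
  exact ⟨_, hp.mem n, rfl⟩

/-- For fixed `y`, `s (p n) y ≤ s (p n) (p (n+1)) ≤ f (p (n+1)) ≤ v`. Only the first argument moves
in the limit along an ultrafilter, so nothing is needed about where `p (n+1)` goes. -/
theorem mapClusterPt_spec (hs : IsMinorantFamily B f s) (hB : IsClosed B) (hp : IsMMSeq B s p)
    {v : ℝ} (hv : Tendsto (fun n => f (p n)) atTop (𝓝 v)) {q : E}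
    (hq : MapClusterPt q atTop p) : q ∈ B ∧ IsMaxOn (s q) B q ∧ f q = v := by
  obtain ⟨U, hU, hUq⟩ := mapClusterPt_iff_ultrafilter.1 hq
  have hqB : q ∈ B := hB.mem_of_tendsto hUq (Eventually.of_forall hp.mem)
  have hUB : Tendsto p U (𝓝[B] q) :=
    tendsto_nhdsWithin_iff.2 ⟨hUq, Eventually.of_forall hp.mem⟩
  have hfq : f q = v :=
    tendsto_nhds_unique ((hs.continuousOn_objective q hqB).tendsto.comp hUB) (hv.mono_left hU)
  refine ⟨hqB, fun y hy => ?_, hfq⟩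
  have hle : s q y ≤ v := by
    refine le_of_tendsto (((hs.continuousOn_left hy) q hqB).tendsto.comp hUB)
      (Eventually.of_forall fun n => ?_)
    exact ((hp.2 n).2 hy).trans ((hs.surrogate_succ_le hp n).trans
      ((hs.monotone hp).ge_of_tendsto hv (n + 1)))
  simpa [hs.touch q hqB, hfq] using hle

end Topological

section Metric

variable {E : Type*} [MetricSpace E] {B : Set E} {f : E → ℝ} {s : E → E → ℝ} {p : ℕ → E}

/-- By compactness it suffices that every cluster point `(a, b)` of the pairs `(p n, p (n+1))` is on
the diagonal. Both `a` and `b` turn out to maximize `s a`, with value `v`, so uniqueness identifies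
them. -/
theorem tendsto_dist_succ (hs : IsMinorantFamily B f s) (hB : IsCompact B) (hp : IsMMSeq B s p)
    (huniq : ∀ x ∈ B, ∃! y, y ∈ B ∧ IsMaxOn (s x) B y) :
    Tendsto (fun n => dist (p (n + 1)) (p n)) atTop (𝓝 0) := by
  obtain ⟨v, hv⟩ := hs.exists_tendsto hB hp
  refine (nhds_basis_zero_abs_lt ℝ).tendsto_right_iff.2 fun ε hε => ?_
  simp only [Set.mem_ofPred_eq, abs_dist]
  refine (hB.prod hB).adherence_nhdset (f := map (fun n => (p n, p (n + 1))) atTop)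
    (t := {z : E × E | dist z.2 z.1 < ε})
    (tendsto_principal.2 (Eventually.of_forall fun n => ⟨hp.mem n, hp.mem (n + 1)⟩))
    (isOpen_lt (by fun_prop) continuous_const) ?_
  rintro ⟨a, b⟩ hab hcl
  obtain ⟨U, hU, hUab⟩ := mapClusterPt_iff_ultrafilter.1 hcl
  obtain ⟨ha, hmax, hfa⟩ := hs.mapClusterPt_spec hB.isClosed hp hv
    (mapClusterPt_iff_ultrafilter.2 ⟨U, hU, hUab.fst_nhds⟩)
  have hsab : s a b = v := by
    refine tendsto_nhds_unique ((hs.continuousOn (a, b) hab).tendsto.comp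
      (tendsto_nhdsWithin_iff.2 ⟨hUab, Eventually.of_forall
        fun n => ⟨hp.mem n, hp.mem (n + 1)⟩⟩)) ?_
    -- The value `s (p n) (p (n+1))` is squeezed between `f (p n)` and `f (p (n+1))`.
    exact tendsto_of_tendsto_of_tendsto_of_le_of_le (hv.mono_left hU)
      (((tendsto_add_atTop_iff_nat 1).2 hv).mono_left hU)
      (fun n => hs.le_surrogate_succ hp n) (fun n => hs.surrogate_succ_le hp n)
  have hba : b = a := by
    refine (huniq a ha).unique ⟨hab.2, fun y hy => ?_⟩ ⟨ha, hmax⟩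
    have := hmax hy
    simp only [Set.mem_ofPred_eq, hs.touch a ha] at this ⊢
    linarith
  simpa [hba] using hε

theorem exists_tendsto_of_isTotallyDisconnected (hs : IsMinorantFamily B f s) (hB : IsCompact B)
    (hp : IsMMSeq B s p) (huniq : ∀ x ∈ B, ∃! y, y ∈ B ∧ IsMaxOn (s x) B y) {C : Set E}
    (hC : IsTotallyDisconnected C) (hpC : ∀ q, MapClusterPt q atTop p → q ∈ C) :
    ∃ q ∈ C, Tendsto p atTop (𝓝 q) := by
  obtain ⟨q, -, hq⟩ := hB.exists_mapClusterPt_of_frequently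
    (show ∃ᶠ n in atTop, p n ∈ B from Frequently.of_forall hp.mem)
  have hsub := hC _ (fun x hx => hpC x hx)
    (isPreconnected_setOf_mapClusterPt hB hp.mem (hs.tendsto_dist_succ hB hp huniq))
  exact ⟨q, hpC q hq, hB.tendsto_nhds_of_unique_mapClusterPt (Eventually.of_forall hp.mem)
    fun x _ hx => hsub hx hq⟩

end Metric

end IsMinorantFamily

theorem IsMMSeq.eq_of_isMaxOn {E : Type*} {B : Set E} {s : E → E → ℝ} {p : ℕ → E}
    (hp : IsMMSeq B s p) (huniq : ∀ x ∈ B, ∃! y, y ∈ B ∧ IsMaxOn (s x) B y) {n : ℕ}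
    (hn : IsMaxOn (s (p n)) B (p n)) : ∀ m, n ≤ m → p m = p n := by
  intro m hm
  induction m, hm using Nat.le_induction with
  | base => rfl
  | succ m hm ih =>
    exact (huniq (p n) (hp.mem n)).unique (ih ▸ hp.2 m) ⟨hp.mem n, hn⟩

/-! ### Sums of logarithms of affine functions: gradients and concavity -/

section LogAffine

variable {ι E : Type*} [Fintype ι] [NormedAddCommGroup E] [InnerProductSpace ℝ E]

/-- A sum of binary logarithms of affine functions. -/
noncomputable def logAffineSum (c : ι → ℝ) (a : ι → E) (p : E) : ℝ :=
  ∑ i, Real.logb 2 (c i + inner ℝ (a i) p)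

/-- The gradient of `logAffineSum c a`. -/
noncomputable def logAffineGrad (c : ι → ℝ) (a : ι → E) (p : E) : E :=
  ∑ i, ((c i + inner ℝ (a i) p) * Real.log 2)⁻¹ • a i

/-- The set on which all the affine functions are positive. -/
def logAffineDomain (c : ι → ℝ) (a : ι → E) : Set E := {p | ∀ i, 0 < c i + inner ℝ (a i) p}

variable {c : ι → ℝ} {a : ι → E} {p q : E}

theorem isOpen_logAffineDomain : IsOpen (logAffineDomain c a) := by
  simp only [logAffineDomain, Set.ofPred_forall]
  exact isOpen_iInter_of_finite fun i => isOpen_lt continuous_const (by fun_prop)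

theorem hasGradientAt_logAffineSum [CompleteSpace E] (hp : p ∈ logAffineDomain c a) :
    HasGradientAt (logAffineSum c a) (logAffineGrad c a p) p := by
  rw [hasGradientAt_iff_hasFDerivAt]
  have h : ∀ i ∈ Finset.univ, HasFDerivAt (fun p => Real.logb 2 (c i + inner ℝ (a i) p))
      (((c i + inner ℝ (a i) p) * Real.log 2)⁻¹ • innerSL ℝ (a i)) p := by
    intro i _
    have h1 : HasFDerivAt (fun p => c i + inner ℝ (a i) p) (innerSL ℝ (a i)) p :=
      (innerSL ℝ (a i)).hasFDerivAt.const_add (c i)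
    convert! (h1.log (hp i).ne').const_mul (Real.log 2)⁻¹ using 1
    · ext x; simp [Real.logb, div_eq_inv_mul]
    · rw [smul_smul, mul_inv, mul_comm]
  convert! HasFDerivAt.fun_sum h using 1
  ext x
  simp [logAffineGrad]

theorem inner_logAffineGrad (x : E) : inner ℝ (logAffineGrad c a p) x =
    ∑ i, inner ℝ (a i) x / ((c i + inner ℝ (a i) p) * Real.log 2) := by
  simp [logAffineGrad, sum_inner, inner_smul_left, div_eq_inv_mul]

/-- This is `log t ≤ t - 1` at `t = y / x`. All concavity used below comes from it and its strict
version. -/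
theorem logb_two_sub_le {x y : ℝ} (hx : 0 < x) (hy : 0 < y) :
    Real.logb 2 y - Real.logb 2 x ≤ (y - x) / (x * Real.log 2) := by
  have h := Real.log_le_sub_one_of_pos (div_pos hy hx)
  rw [Real.log_div hy.ne' hx.ne'] at h
  have h2 : 0 < Real.log 2 := Real.log_pos one_lt_two
  rw [Real.logb, Real.logb, ← sub_div, ← div_div, sub_div y x x, div_self hx.ne']
  exact div_le_div_of_nonneg_right h h2.le

theorem logb_two_sub_lt {x y : ℝ} (hx : 0 < x) (hy : 0 < y) (hxy : y ≠ x) :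
    Real.logb 2 y - Real.logb 2 x < (y - x) / (x * Real.log 2) := by
  have h := Real.log_lt_sub_one_of_pos (div_pos hy hx) (by rwa [Ne, div_eq_one_iff_eq hx.ne'])
  rw [Real.log_div hy.ne' hx.ne'] at h
  have h2 : 0 < Real.log 2 := Real.log_pos one_lt_two
  rw [Real.logb, Real.logb, ← sub_div, ← div_div, sub_div y x x, div_self hx.ne']
  exact div_lt_div_of_pos_right h h2

theorem logAffineSum_le (hp : p ∈ logAffineDomain c a) (hq : q ∈ logAffineDomain c a) :
    logAffineSum c a q ≤ logAffineSum c a p + inner ℝ (logAffineGrad c a p) (q - p) := by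
  rw [← sub_le_iff_le_add', inner_logAffineGrad, logAffineSum, logAffineSum,
    ← Finset.sum_sub_distrib]
  refine Finset.sum_le_sum fun i _ => (logb_two_sub_le (hp i) (hq i)).trans_eq ?_
  rw [inner_sub_right]; ring

theorem logAffineSum_lt (hp : p ∈ logAffineDomain c a) (hq : q ∈ logAffineDomain c a)
    (hpq : ∃ i, inner ℝ (a i) (q - p) ≠ 0) :
    logAffineSum c a q < logAffineSum c a p + inner ℝ (logAffineGrad c a p) (q - p) := by
  obtain ⟨i, hi⟩ := hpq
  rw [inner_sub_right] at hi
  rw [← sub_lt_iff_lt_add', inner_logAffineGrad, logAffineSum, logAffineSum,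
    ← Finset.sum_sub_distrib]
  refine Finset.sum_lt_sum (fun j _ => (logb_two_sub_le (hp j) (hq j)).trans_eq ?_)
    ⟨i, Finset.mem_univ i, (logb_two_sub_lt (hp i) (hq i) fun h => hi ?_).trans_eq ?_⟩
  · rw [inner_sub_right]; ring
  · linarith
  · rw [inner_sub_right]; ring

theorem continuousOn_logAffineSum : ContinuousOn (logAffineSum c a) (logAffineDomain c a) := by
  refine continuousOn_finsetSum _ fun i _ => ?_
  exact ContinuousOn.div_const (ContinuousOn.log (by fun_prop) fun p hp => (hp i).ne') _

theorem continuousOn_logAffineGrad : ContinuousOn (logAffineGrad c a) (logAffineDomain c a) := by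
  refine continuousOn_finsetSum _ fun i _ => ContinuousOn.smul
    (ContinuousOn.inv₀ (by fun_prop) fun p hp => ?_) continuousOn_const
  exact (mul_pos (hp i) (Real.log_pos one_lt_two)).ne'

/-- The midpoint of two points at which a log-affine sum is not affine in between. -/
theorem logAffineSum_midpoint_lt {m : E} (hm : m ∈ logAffineDomain c a)
    (hp : p ∈ logAffineDomain c a) (hq : q ∈ logAffineDomain c a) (hmid : m = (2⁻¹ : ℝ) • (p + q))
    (hpq : ∃ i, inner ℝ (a i) (q - p) ≠ 0) :
    logAffineSum c a p + logAffineSum c a q < 2 * logAffineSum c a m := by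
  have h1 := logAffineSum_le hm hp
  -- The tangent inequalities at `m` towards `p` and `q` have opposite linear terms, which cancel
  -- when added.
  have hqm : q - m = (2⁻¹ : ℝ) • (q - p) := by rw [hmid]; module
  have hpm : p - m = -(q - m) := by rw [hmid]; module
  have h2 := logAffineSum_lt hm hq (by
    obtain ⟨i, hi⟩ := hpq
    exact ⟨i, by rw [hqm, inner_smul_right]; positivity⟩)
  rw [hpm, inner_neg_right] at h1
  linarith

end LogAffine

/-! ### Multipliers for box constraints -/

section Box

variable {ι : Type*} [Fintype ι]

/-- Multipliers of a box-constrained problem exist if and only if the first-order variational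
inequality holds. -/
theorem exists_box_multipliers_iff {b : ι → ℝ} {q : EuclideanSpace ℝ ι}
    (hq : ∀ k, 0 ≤ q k ∧ q k ≤ b k) (g : EuclideanSpace ℝ ι) :
    (∃ lo up : ι → ℝ, ∀ k, 0 ≤ lo k ∧ 0 ≤ up k ∧ g k + lo k - up k = 0 ∧ lo k * q k = 0 ∧
      up k * (b k - q k) = 0) ↔
    ∀ y : EuclideanSpace ℝ ι, (∀ k, 0 ≤ y k ∧ y k ≤ b k) → inner ℝ g (y - q) ≤ 0 := by
  classical
  constructor
  · rintro ⟨lo, up, h⟩ y hy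
    rw [PiLp.inner_apply]
    refine Finset.sum_nonpos fun k _ => ?_
    obtain ⟨h1, h2, h3, h4, h5⟩ := h k
    have h6 := mul_nonneg h1 (hy k).1
    have h7 := mul_nonneg h2 (sub_nonneg.2 (hy k).2)
    have h8 : g k = up k - lo k := by linarith
    simp only [RCLike.inner_apply, conj_trivial, PiLp.sub_apply, h8]
    linarith
  · intro h
    -- Varying one coordinate at a time decouples the variational inequality.
    have key : ∀ k t, 0 ≤ t → t ≤ b k → g k * (t - q k) ≤ 0 := by
      intro k t h0 hb
      have := h (q + EuclideanSpace.single k (t - q k)) fun j => by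
        by_cases hj : j = k
        · subst hj; simpa using ⟨h0, hb⟩
        · simpa [hj] using hq j
      simpa [EuclideanSpace.inner_single_right, mul_comm] using this
    -- The multipliers are the negative and positive parts of `g k`; testing with `t = 0` and `t = b
    -- k` yields complementary slackness.
    refine ⟨fun k => max (-g k) 0, fun k => max (g k) 0, fun k =>
      ⟨le_max_right _ _, le_max_right _ _, ?_⟩⟩
    have h1 := key k 0 le_rfl ((hq k).1.trans (hq k).2)
    have h2 := key k (b k) ((hq k).1.trans (hq k).2) le_rfl
    rcases le_total 0 (g k) with hg | hg
    · beta_reduce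
      have := mul_nonneg hg (sub_nonneg.2 (hq k).2)
      rw [max_eq_right (neg_nonpos.2 hg), max_eq_left hg]
      exact ⟨by ring, by ring, le_antisymm h2 this⟩
    · beta_reduce
      have := mul_nonneg (neg_nonneg.2 hg) (hq k).1
      rw [max_eq_left (neg_nonneg.2 hg), max_eq_right hg]
      exact ⟨by ring, by linarith, by ring⟩

end Box

/-! ### Quotient gradients, the feasible box, and the log-affine form of the network rates -/

noncomputable section

/-- In this form the gradient depends on `R` only through its value and gradient at `x`, so
numerators that agree to first order give literally the same vector. -/
theorem HasGradientAt.fun_div {E : Type*} [NormedAddCommGroup E] [InnerProductSpace ℝ E]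
    [CompleteSpace E] {R P : E → ℝ} {r m x : E} (hR : HasGradientAt R r x)
    (hP : HasGradientAt P m x) (hx : P x ≠ 0) :
    HasGradientAt (fun y => R y / P y) ((P x)⁻¹ • (r - (R x / P x) • m)) x := by
  rw [hasGradientAt_iff_hasFDerivAt] at *
  have h := hR.mul ((hasDerivAt_inv hx).comp_hasFDerivAt x hP)
  convert! h using 1
  ext y
  simp
  field_simp
  ring

namespace SecrecyNetwork

variable {K N NB : ℕ} (S : SecrecyNetwork K N NB)

section Box

theorem isCompact_box : IsCompact S.box := by
  have h : S.box = (EuclideanSpace.equiv (Fin K) ℝ).toHomeomorph ⁻¹'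
      (Set.univ.pi fun k => Set.Icc 0 (S.Pmax k)) := by
    ext p
    simp only [box, Set.mem_ofPred_eq, Set.mem_preimage, Set.mem_pi, Set.mem_univ, true_imp_iff,
      Set.mem_Icc]
    rfl
  rw [h, Homeomorph.isCompact_preimage]
  exact isCompact_univ_pi fun _ => isCompact_Icc

theorem convex_box : Convex ℝ S.box := by
  intro p hp q hq a b ha hb hab k
  have h1 := mul_le_mul_of_nonneg_left (hp k).2 ha
  have h2 := mul_le_mul_of_nonneg_left (hq k).2 hb
  have h3 : S.Pmax k = a * S.Pmax k + b * S.Pmax k := by rw [← add_mul, hab, one_mul]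
  have h4 := mul_nonneg ha (hp k).1
  have h5 := mul_nonneg hb (hq k).1
  simp only [PiLp.add_apply, PiLp.smul_apply, smul_eq_mul]
  constructor <;> linarith

end Box

section Coefficients

open scoped ComplexOrder

variable {S}

theorem posSemidef_RE (hG : 0 ≤ S.varG) : S.RE.PosSemidef :=
  (Matrix.posSemidef_vecMulVec_self_star _).add
    (Matrix.PosSemidef.one.smul (by exact_mod_cast hG))

theorem posDef_WB (hB : 0 < S.varB) (hRIS : 0 ≤ S.varRIS) : S.WB.PosDef := by
  refine (Matrix.PosDef.one.smul (by exact_mod_cast hB)).add_posSemidef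
    (Matrix.PosSemidef.smul ?_ (by exact_mod_cast hRIS))
  have := Matrix.posSemidef_self_mul_conjTranspose (S.GB * S.Gam)
  rwa [Matrix.conjTranspose_mul, ← Matrix.mul_assoc] at this

theorem aB_nonneg (k m : Fin K) : 0 ≤ S.aB k m := sq_nonneg _

theorem aE_nonneg (hG : 0 ≤ S.varG) (m : Fin K) : 0 ≤ S.aE m :=
  (posSemidef_RE hG).re_dotProduct_nonneg _

theorem dB_pos (hB : 0 < S.varB) (hRIS : 0 ≤ S.varRIS) {k : Fin K} (hc : S.c k ≠ 0) :
    0 < S.dB k :=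
  (posDef_WB hB hRIS).re_dotProduct_pos hc

theorem dE_pos (hE : 0 < S.varE) (hRIS : 0 ≤ S.varRIS) (hG : 0 ≤ S.varG) : 0 < S.dE :=
  add_pos_of_nonneg_of_pos (mul_nonneg hRIS ((posSemidef_RE hG).re_dotProduct_nonneg _)) hE

end Coefficients

section LogAffine

/-- The constant terms of the affine functions in `g1` and `g2`. -/
def offset : Fin K ⊕ Fin K → ℝ := Sum.elim S.dB fun _ => S.dE

/-- The coefficient vectors of the affine functions in `g1`. -/
def coeff1 : Fin K ⊕ Fin K → EuclideanSpace ℝ (Fin K) :=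
  Sum.elim (fun k => WithLp.toLp 2 (S.aB k)) fun k => WithLp.toLp 2 (Function.update S.aE k 0)

/-- The coefficient vectors of the affine functions in `g2`. -/
def coeff2 : Fin K ⊕ Fin K → EuclideanSpace ℝ (Fin K) :=
  Sum.elim (fun k => WithLp.toLp 2 (Function.update (S.aB k) k 0)) fun _ => WithLp.toLp 2 S.aE

/-- The region on which all the logarithms in `g1` and `g2` have positive arguments. -/
def domain : Set (EuclideanSpace ℝ (Fin K)) :=
  logAffineDomain S.offset S.coeff1 ∩ logAffineDomain S.offset S.coeff2

theorem inner_toLp (a : Fin K → ℝ) (p : EuclideanSpace ℝ (Fin K)) :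
    inner ℝ (WithLp.toLp 2 a) p = ∑ m, p m * a m := by
  simp [PiLp.inner_apply]

theorem inner_toLp_update (a : Fin K → ℝ) (k : Fin K) (p : EuclideanSpace ℝ (Fin K)) :
    inner ℝ (WithLp.toLp 2 (Function.update a k 0)) p
      = ∑ m ∈ Finset.univ.erase k, p m * a m := by
  rw [inner_toLp, ← Finset.add_sum_erase _ _ (Finset.mem_univ k)]
  simp only [Function.update_self, mul_zero, zero_add]
  exact Finset.sum_congr rfl fun m hm => by rw [Function.update_of_ne (Finset.ne_of_mem_erase hm)]

theorem g1_eq : S.g1 = logAffineSum S.offset S.coeff1 := by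
  ext p
  simp only [g1, logAffineSum, offset, coeff1, Fintype.sum_sum_type, Sum.elim_inl, Sum.elim_inr,
    inner_toLp_update, Finset.sum_add_distrib]
  simp only [inner_toLp]

theorem g2_eq : S.g2 = logAffineSum S.offset S.coeff2 := by
  ext p
  simp only [g2, logAffineSum, offset, coeff2, Fintype.sum_sum_type, Sum.elim_inl, Sum.elim_inr,
    inner_toLp_update, Finset.sum_add_distrib]
  simp only [inner_toLp]

theorem isOpen_domain : IsOpen S.domain :=
  isOpen_logAffineDomain.inter isOpen_logAffineDomain

theorem secrecyRate_eq {S : SecrecyNetwork K N NB} {p : EuclideanSpace ℝ (Fin K)} (hp : p ∈ S.domain) :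
    S.secrecyRate p = S.g1 p - S.g2 p := by
  -- Each rate is the logarithm of signal plus interference plus noise, minus that of interference
  -- plus noise.
  have hlog : ∀ x y : ℝ, 0 < y → 0 < y + x →
      Real.logb 2 (1 + x / y) = Real.logb 2 (y + x) - Real.logb 2 y := by
    intro x y hy hxy
    rw [← Real.logb_div hxy.ne' hy.ne', add_div, div_self hy.ne']
  rw [secrecyRate, g1, g2, ← Finset.sum_sub_distrib]
  refine Finset.sum_congr rfl fun k _ => ?_
  have h1 := hp.1 (Sum.inl k)
  have h2 := hp.1 (Sum.inr k)
  have h3 := hp.2 (Sum.inl k)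
  have h4 := hp.2 (Sum.inr k)
  simp only [offset, coeff1, coeff2, Sum.elim_inl, Sum.elim_inr, inner_toLp_update]
    at h1 h2 h3 h4
  simp only [inner_toLp] at h1 h4
  rw [← Finset.add_sum_erase _ _ (Finset.mem_univ k), add_comm (p k * _), ← add_assoc] at h1 h4
  rw [sinrB, sinrE, hlog _ _ h3 h1, hlog _ _ h2 h4,
    ← Finset.add_sum_erase _ (fun m => p m * S.aB k m) (Finset.mem_univ k),
    ← Finset.add_sum_erase _ (fun m => p m * S.aE m) (Finset.mem_univ k),
    add_comm (p k * S.aB k k), add_comm (p k * S.aE k), ← add_assoc, ← add_assoc]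
  ring

end LogAffine

/-! ### The surrogate as a minorant, and KKT points as its fixed points -/

/-- The standing assumptions of the power allocation problem. -/
structure Admissible : Prop where
  dB_pos : ∀ k, 0 < S.dB k
  dE_pos : 0 < S.dE
  aE_nonneg : ∀ m, 0 ≤ S.aE m
  Ptot_pos : ∀ p ∈ S.box, 0 < S.Ptot p

variable {S} {p q : EuclideanSpace ℝ (Fin K)}

theorem Admissible.box_subset_domain (hS : S.Admissible) : S.box ⊆ S.domain := by
  intro p hp
  constructor <;> rintro (k | k) <;>
    simp only [offset, coeff1, coeff2, Sum.elim_inl, Sum.elim_inr, inner_toLp_update] <;>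
    try simp only [inner_toLp]
  · exact add_pos_of_pos_of_nonneg (hS.dB_pos k)
      (Finset.sum_nonneg fun m _ => mul_nonneg (hp m).1 (aB_nonneg k m))
  · exact add_pos_of_pos_of_nonneg hS.dE_pos
      (Finset.sum_nonneg fun m _ => mul_nonneg (hp m).1 (hS.aE_nonneg m))
  · exact add_pos_of_pos_of_nonneg (hS.dB_pos k)
      (Finset.sum_nonneg fun m _ => mul_nonneg (hp m).1 (aB_nonneg k m))
  · exact add_pos_of_pos_of_nonneg hS.dE_pos
      (Finset.sum_nonneg fun m _ => mul_nonneg (hp m).1 (hS.aE_nonneg m))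

theorem Ptot_eq (p : EuclideanSpace ℝ (Fin K)) :
    S.Ptot p = inner ℝ (WithLp.toLp 2 S.mueq) p + S.Pceq := by
  rw [inner_toLp, Ptot]
  simp only [mul_comm]

theorem hasGradientAt_Ptot (p : EuclideanSpace ℝ (Fin K)) :
    HasGradientAt S.Ptot (WithLp.toLp 2 S.mueq) p := by
  rw [hasGradientAt_iff_hasFDerivAt]
  refine ((innerSL ℝ (WithLp.toLp 2 S.mueq : EuclideanSpace ℝ (Fin K))).hasFDerivAt.add_const
    S.Pceq).congr_of_eventuallyEq (Eventually.of_forall fun x => ?_)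
  simp [Ptot_eq]

theorem gradient_g2 (hp : p ∈ S.domain) :
    gradient S.g2 p = logAffineGrad S.offset S.coeff2 p := by
  rw [g2_eq]
  exact (hasGradientAt_logAffineSum hp.2).gradient

/-- The gradient of the secrecy rate. -/
def rateGrad (S : SecrecyNetwork K N NB) (p : EuclideanSpace ℝ (Fin K)) :
    EuclideanSpace ℝ (Fin K) :=
  logAffineGrad S.offset S.coeff1 p - logAffineGrad S.offset S.coeff2 p

theorem hasGradientAt_secrecyRate (hp : p ∈ S.domain) :
    HasGradientAt S.secrecyRate (S.rateGrad p) p := by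
  refine HasGradientAt.congr_of_eventuallyEq (f := fun x => S.g1 x - S.g2 x) ?_ ?_
  · have h1 := hasGradientAt_logAffineSum hp.1
    have h2 := hasGradientAt_logAffineSum hp.2
    rw [← g1_eq] at h1
    rw [← g2_eq] at h2
    rw [hasGradientAt_iff_hasFDerivAt] at *
    rw [rateGrad, map_sub]
    exact h1.fun_sub h2
  · filter_upwards [S.isOpen_domain.mem_nhds hp] with x hx using secrecyRate_eq hx

theorem hasGradientAt_surrogateRate (hp : p ∈ S.domain) :
    HasGradientAt (S.surrogateRate p) (S.rateGrad p) p := by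
  have h1 := hasGradientAt_logAffineSum hp.1
  rw [← g1_eq] at h1
  rw [hasGradientAt_iff_hasFDerivAt] at *
  rw [rateGrad, map_sub]
  refine (h1.sub_const (S.g2 p)).fun_sub ?_
  rw [gradient_g2 hp]
  exact (innerSL ℝ (logAffineGrad S.offset S.coeff2 p)).hasFDerivAt.comp p
    ((hasFDerivAt_id p).sub_const p)

theorem surrogateRate_self (hp : p ∈ S.domain) : S.surrogateRate p p = S.secrecyRate p := by
  simp [surrogateRate, secrecyRate_eq hp]

theorem surrogateRate_le_secrecyRate (hp : p ∈ S.domain) (hq : q ∈ S.domain) :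
    S.surrogateRate p q ≤ S.secrecyRate q := by
  have := logAffineSum_le hp.2 hq.2
  rw [surrogateRate, secrecyRate_eq hq, gradient_g2 hp, g2_eq]
  linarith

/-- The surrogate rate is `g1` plus an affine function, hence concave. -/
theorem surrogateRate_le_tangent (hp : p ∈ S.domain) (hq : q ∈ S.domain) :
    S.surrogateRate p q ≤ S.surrogateRate p p + inner ℝ (S.rateGrad p) (q - p) := by
  have := logAffineSum_le hp.1 hq.1
  rw [surrogateRate, surrogateRate, rateGrad, gradient_g2 hp, g1_eq, inner_sub_left, sub_self,
    inner_zero_right]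
  linarith

/-- The gradient of the objective. -/
def objectiveGrad (S : SecrecyNetwork K N NB) (p : EuclideanSpace ℝ (Fin K)) :
    EuclideanSpace ℝ (Fin K) :=
  (S.Ptot p)⁻¹ • (S.rateGrad p - S.objective p • WithLp.toLp 2 S.mueq)

theorem Admissible.hasGradientAt_objective (hS : S.Admissible) (hp : p ∈ S.box) :
    HasGradientAt S.objective (S.objectiveGrad p) p :=
  (hasGradientAt_secrecyRate (hS.box_subset_domain hp)).fun_div (hasGradientAt_Ptot p)
    (hS.Ptot_pos p hp).ne'

theorem Admissible.hasGradientAt_surrogate (hS : S.Admissible) (hp : p ∈ S.box) :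
    HasGradientAt (S.surrogate p) (S.objectiveGrad p) p := by
  have hd := hS.box_subset_domain hp
  have h := (hasGradientAt_surrogateRate hd).fun_div (hasGradientAt_Ptot p)
    (hS.Ptot_pos p hp).ne'
  rwa [surrogateRate_self hd] at h

/-- Necessity is the first-order condition on a convex set, the two gradients at `q` being equal.
For sufficiency, with `r` the rate gradient, the inequality reads `⟨r, y - q⟩ ≤ f q * (P y - P q)`;
adding it to the tangent bound leaves `surrogateRate q y ≤ f q * P y`. -/
theorem Admissible.isMaxOn_surrogate_iff (hS : S.Admissible) (hq : q ∈ S.box) :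
    IsMaxOn (S.surrogate q) S.box q ↔
      ∀ y ∈ S.box, inner ℝ (gradient S.objective q) (y - q) ≤ 0 := by
  rw [(hS.hasGradientAt_objective hq).gradient]
  constructor
  · intro h y hy
    have := h.localize.hasFDerivWithinAt_nonpos
      (hasGradientAt_iff_hasFDerivAt.1 (hS.hasGradientAt_surrogate hq)).hasFDerivWithinAt
      (sub_mem_posTangentConeAt_of_segment_subset (S.convex_box.segment_subset hq hy))
    simpa using this
  · intro h y hy
    have hPq := hS.Ptot_pos q hq
    have hPy := hS.Ptot_pos y hy
    have hqd := hS.box_subset_domain hq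
    have h1 := h y hy
    rw [objectiveGrad, inner_smul_left, inner_sub_left, inner_smul_left] at h1
    have h2 := nonpos_of_mul_nonpos_right h1 (inv_pos.2 hPq)
    have h3 : inner ℝ (WithLp.toLp 2 S.mueq : EuclideanSpace ℝ (Fin K)) (y - q)
        = S.Ptot y - S.Ptot q := by
      rw [Ptot_eq, Ptot_eq, inner_sub_right]; ring
    have h4 := surrogateRate_le_tangent hqd (hS.box_subset_domain hy)
    have h5 : S.surrogateRate q q = S.objective q * S.Ptot q := by
      rw [surrogateRate_self hqd, objective, div_mul_cancel₀ _ hPq.ne']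
    have h6 : S.surrogate q q = S.objective q := by
      rw [surrogate, surrogateRate_self hqd, objective]
    simp only [Set.mem_ofPred_eq, h6]
    rw [surrogate, div_le_iff₀ hPy]
    simp only [conj_trivial, h3] at h2
    linarith

theorem Admissible.isKKT_iff (hS : S.Admissible) :
    S.IsKKT q ↔ q ∈ S.box ∧ IsMaxOn (S.surrogate q) S.box q := by
  refine and_congr_right fun hq => ?_
  rw [hS.isMaxOn_surrogate_iff hq, exists_box_multipliers_iff hq]
  exact and_iff_right (hS.hasGradientAt_objective hq).differentiableAt

theorem Admissible.isMinorantFamily (hS : S.Admissible) :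
    IsMinorantFamily S.box S.objective S.surrogate where
  continuousOn := by
    have hd := hS.box_subset_domain
    have h1 : ContinuousOn S.g1 S.box := by
      rw [g1_eq]
      exact continuousOn_logAffineSum.mono fun p hp => (hd hp).1
    have h2 : ContinuousOn S.g2 S.box := by
      rw [g2_eq]
      exact continuousOn_logAffineSum.mono fun p hp => (hd hp).2
    have h3 : ContinuousOn (gradient S.g2) S.box :=
      (continuousOn_logAffineGrad.mono fun p hp => (hd hp).2).congr fun p hp => gradient_g2 (hd hp)
    have hfst : Set.MapsTo Prod.fst (S.box ×ˢ S.box) S.box := fun z hz => hz.1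
    have hsnd : Set.MapsTo Prod.snd (S.box ×ˢ S.box) S.box := fun z hz => hz.2
    have hP : Continuous S.Ptot := by unfold Ptot; fun_prop
    refine ContinuousOn.div (((h1.comp continuousOn_snd hsnd).sub
      (h2.comp continuousOn_fst hfst)).sub ((h3.comp continuousOn_fst hfst).inner (by fun_prop)))
      (by fun_prop) fun z hz => (hS.Ptot_pos _ hz.2).ne'
  touch p hp := by
    rw [surrogate, surrogateRate_self (hS.box_subset_domain hp), objective]
  le p hp q hq := div_le_div_of_nonneg_right (surrogateRate_le_secrecyRate
    (hS.box_subset_domain hp) (hS.box_subset_domain hq)) (hS.Ptot_pos q hq).le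

/-! ### Uniqueness of the surrogate solution -/

/-- This supplies strict concavity of `g1` in every direction. If all forms vanish at `d`, Eve's
forms make every `d k * aE k` equal to their sum `T`, so `T = K * T`. Either `T = 0`, which kills
`d`, or `K = 1`, where Eve's form is zero and Bob's decides. -/
theorem exists_inner_coeff1_ne_zero (hpos : ∀ k, 0 < S.aB k k ∧ 0 < S.aE k)
    {d : EuclideanSpace ℝ (Fin K)} (hd : d ≠ 0) : ∃ i, inner ℝ (S.coeff1 i) d ≠ 0 := by
  by_contra! h
  set T := ∑ m, d m * S.aE m with hT
  have hE : ∀ k, d k * S.aE k = T := fun k => by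
    have := h (Sum.inr k)
    simp only [coeff1, Sum.elim_inr, inner_toLp_update] at this
    rw [hT, ← Finset.add_sum_erase _ _ (Finset.mem_univ k), this, add_zero]
  refine hd (PiLp.ext fun k => ?_)
  by_cases hT0 : T = 0
  · exact (mul_eq_zero.1 ((hE k).trans hT0)).resolve_right (hpos k).2.ne'
  · have hK : (K : ℝ) = 1 := by
      have : T = K * T := by
        conv_lhs => rw [hT, Finset.sum_congr rfl fun m _ => hE m]
        simp
      exact mul_right_cancel₀ hT0 (by linarith)
    obtain rfl : K = 1 := by exact_mod_cast hK
    have := h (Sum.inl k)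
    simp only [coeff1, Sum.elim_inl, inner_toLp] at this
    rw [Fintype.sum_subsingleton _ k] at this
    exact (mul_eq_zero.1 this).resolve_right (hpos k).1.ne'

/-- With `t` the common maximum of the ratio, `surrogateRate x - t * Ptot` is nonpositive on the box
and zero at both maximizers. Strict concavity would make it positive at their midpoint. -/
theorem Admissible.solvesSurrogate_unique (hS : S.Admissible)
    (hpos : ∀ k, 0 < S.aB k k ∧ 0 < S.aE k) {x : EuclideanSpace ℝ (Fin K)}
    (hp : S.SolvesSurrogate x p) (hq : S.SolvesSurrogate x q) : p = q := by
  by_contra hne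
  have hd := hS.box_subset_domain
  obtain ⟨m, hm⟩ : ∃ m, m = (2⁻¹ : ℝ) • (p + q) := ⟨_, rfl⟩
  have hmB : m ∈ S.box := by
    rw [hm, smul_add]
    exact S.convex_box hp.1 hq.1 (by norm_num) (by norm_num) (by norm_num)
  have hlt := logAffineSum_midpoint_lt (hd hmB).1 (hd hp.1).1 (hd hq.1).1 hm
    (exists_inner_coeff1_ne_zero hpos (sub_ne_zero.2 (Ne.symm hne)))
  have hpq : S.surrogate x p = S.surrogate x q := le_antisymm (hq.2 hp.1) (hp.2 hq.1)
  have hmp : S.surrogate x m ≤ S.surrogate x q := hq.2 hmB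
  have h1 : S.surrogateRate x p = S.surrogate x q * S.Ptot p := by
    rw [← hpq, surrogate, div_mul_cancel₀ _ (hS.Ptot_pos p hp.1).ne']
  have h2 : S.surrogateRate x q = S.surrogate x q * S.Ptot q := by
    rw [surrogate, div_mul_cancel₀ _ (hS.Ptot_pos q hq.1).ne']
  have h3 : S.surrogateRate x m ≤ S.surrogate x q * S.Ptot m := by
    rwa [← div_le_iff₀ (hS.Ptot_pos m hmB)]
  have h4 : S.Ptot p + S.Ptot q = 2 * S.Ptot m := by
    simp only [Ptot_eq, hm, inner_smul_right, inner_add_right]; ring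
  have h5 : inner ℝ (gradient S.g2 x) (p - x) + inner ℝ (gradient S.g2 x) (q - x)
      = 2 * inner ℝ (gradient S.g2 x) (m - x) := by
    simp only [hm, inner_sub_right, inner_smul_right, inner_add_right]; ring
  rw [← g1_eq] at hlt
  have h6 : S.surrogateRate x p + S.surrogateRate x q < 2 * S.surrogateRate x m := by
    simp only [surrogateRate]; linarith
  have h7 : S.surrogate x q * S.Ptot p + S.surrogate x q * S.Ptot q
      = 2 * (S.surrogate x q * S.Ptot m) := by
    rw [← mul_add, h4]; ring
  linarith

end SecrecyNetwork

end

/-! ### The proposition -/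

theorem proposition2 {K N NB : ℕ} (S : SecrecyNetwork K N NB)
    (hB : 0 < S.varB) (hE : 0 < S.varE) (hRIS : 0 ≤ S.varRIS) (hG : 0 ≤ S.varG)
    (hc : ∀ k, S.c k ≠ 0) (hP : ∀ p ∈ S.box, 0 < S.Ptot p) :
    -- each step can be carried out, and its result is unique for nondegenerate channels
    (∀ pbar ∈ S.box, ∃ q, S.SolvesSurrogate pbar q) ∧
    ((∀ k, 0 < S.aB k k ∧ 0 < S.aE k) →
      ∀ pbar ∈ S.box, ∃! q, S.SolvesSurrogate pbar q) ∧
    ∀ p : ℕ → EuclideanSpace ℝ (Fin K), S.IsRun p →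
      -- monotone improvement, strict away from KKT points
      Monotone (fun n => S.objective (p n)) ∧
      (∀ n, ¬ S.IsKKT (p n) → S.objective (p n) < S.objective (p (n + 1))) ∧
      -- convergence to KKT points
      ∃ v : ℝ, Tendsto (fun n => S.objective (p n)) atTop (𝓝 v) ∧
        (∃ q, MapClusterPt q atTop p) ∧
        (∀ q, MapClusterPt q atTop p → S.IsKKT q ∧ S.objective q = v) ∧
        Tendsto (fun n => Metric.infDist (p n) {q | S.IsKKT q ∧ S.objective q = v})
          atTop (𝓝 0) ∧
        -- if the solution of each surrogate problem is unique
        ((∀ pbar ∈ S.box, ∃! q, S.SolvesSurrogate pbar q) →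
          Tendsto (fun n => ‖p (n + 1) - p n‖) atTop (𝓝 0) ∧
          (∀ n, S.IsKKT (p n) → ∀ m, n ≤ m → p m = p n) ∧
          (IsTotallyDisconnected {q | S.IsKKT q ∧ S.objective q = v} →
            ∃ q, S.IsKKT q ∧ Tendsto p atTop (𝓝 q))) := by
  have hS : S.Admissible :=
    ⟨fun k => SecrecyNetwork.dB_pos hB hRIS (hc k), SecrecyNetwork.dE_pos hE hRIS hG,
      SecrecyNetwork.aE_nonneg hG, hP⟩
  have hM := hS.isMinorantFamily
  have hcomp := S.isCompact_box
  have hsolve : ∀ pbar ∈ S.box, ∃ q, S.SolvesSurrogate pbar q := fun _ h =>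
    hM.exists_isMaxOn hcomp h
  refine ⟨hsolve, fun hpos x hx => ?_, fun p hp => ?_⟩
  · obtain ⟨q, hq⟩ := hsolve x hx
    exact ⟨q, hq, fun y hy => hS.solvesSurrogate_unique hpos hy hq⟩
  -- `IsRun` unfolds definitionally to the abstract iteration.
  have hmm : IsMMSeq S.box S.surrogate p := hp
  obtain ⟨v, hv⟩ := hM.exists_tendsto hcomp hmm
  have hcl : ∀ q, MapClusterPt q atTop p → S.IsKKT q ∧ S.objective q = v := fun q hq =>
    let ⟨h1, h2, h3⟩ := hM.mapClusterPt_spec hcomp.isClosed hmm hv hq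
    ⟨hS.isKKT_iff.2 ⟨h1, h2⟩, h3⟩
  have hmem : ∀ᶠ n in atTop, p n ∈ S.box := Eventually.of_forall hmm.mem
  refine ⟨hM.monotone hmm, fun n hn => hM.lt_succ hmm fun h => hn (hS.isKKT_iff.2
    ⟨hmm.mem n, h⟩), v, hv, ?_, hcl, hcomp.tendsto_infDist_of_mapClusterPt hmem hcl,
    fun huniq => ⟨?_, fun n hn => hmm.eq_of_isMaxOn huniq (hS.isKKT_iff.1 hn).2, fun hdis => ?_⟩⟩
  · obtain ⟨q, -, hq⟩ := hcomp.exists_mapClusterPt_of_frequently hmem.frequently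
    exact ⟨q, hq⟩
  · simpa only [dist_eq_norm] using hM.tendsto_dist_succ hcomp hmm huniq
  · obtain ⟨q, hq, hlim⟩ := hM.exists_tendsto_of_isTotallyDisconnected hcomp hmm huniq hdis hcl
    exact ⟨q, hq.1, hlim⟩
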